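/- Let $K$ be a field, let $n\ge 0$, and let $A$ be an associative unital $K$-algebra with elements $x_1,\dots,x_n\in A$. Suppose that $A$ is a pre-commutative skew PBW extension of $K$ in $x_1,\dots,x_n$; that is, the standard monomials $x_1^{\alpha_1}\cdots x_n^{\alpha_n}$ ($\alpha\in\mathbb N^n$) form a $K$-basis of $A$, and for all $1\le i,j\le n$ there is $c_{ij}\in K\setminus\{0\}$ with $x_jx_i-c_{ij}x_ix_j\in Kx_1+\dots+Kx_n$. (The remaining condition in the definition of a skew PBW extension of a ring $R$, namely that for every $i$ and every $r\in R\setminus\{0\}$ there is $c_{i,r}\in R\setminus\{0\}$ with $x_ir-c_{i,r}x_i\in R$, holds automatically here, since $R=K$ is central in $A$.) Let $L=K\langle X_1,\dots,X_n\rangle$ be the free algebra and $L_m\subseteq L$ the span of the words of length $m$. Given a set $S\subseteq L_1\oplus L_2$, the algebra $A$ is *pre-Koszul with relations $S$* if $X_i\mapsto x_i$ induces an isomorphism $L/\langle S\rangle\cong A$. Its *associated homogeneous algebra* is then $A^{(0)}=L/\langle q(S)\rangle$, where $q(S)\subseteq L_2$ is the set of quadratic parts of the elements of $S$. A quotient $B=L/\langle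 T\rangle$ with $T\subseteq L_2$ is *homogeneous Koszul* if the trivial graded left $B$-module $K$ has a linear free resolution $\cdots\to P_2\to P_1\to P_0\to K\to 0$, that is, a graded resolution in which each $P_i$ is a graded free $B$-module generated in degree $i$. Finally, $A$ is *Koszul* (in Priddy's sense) *with relations $S$* if it is pre-Koszul with relations $S$ and $A^{(0)}$ is homogeneous Koszul. **Theorem 3.14.** Under these hypotheses: 1. $A$ is Koszul with relations $S_{\mathrm{all}}$, the set of all $f\in L_1\oplus L_2$ that vanish at $(x_1,\dots,x_n)$. 2. For all $c_{ij}\in K\setminus\{0\}$ and $a_{ijt}\in K$ such that $x_jx_i-c_{ij}x_ix_j=\sum_t a_{ijt}x_t$ for all $i,j$, the algebra $A$ is Koszul with relations $S=\{X_jX_i-c_{ij}X_iX_j-\sum_t a_{ijt}X_t \mid 1\le i,j\le n\}$. Moreover, the relations $S$ and $S_{\mathrm{all}}$ give the same associated homogeneous algebra, $$A^{(0)}=A^\sigma:=K\langle X_1,\dots,X_n\rangle/\langle X_jX_i-c_{ij}X_iX_j \mid 1\le i,j\le n\rangle .$$ -/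

import Mathlib

namespace SkewPBW

universe u v

/-! ### Skew PBW extensions -/

/-- The standard monomial `x₁ ^ α₁ * ⋯ * xₙ ^ αₙ` (factors in this order). -/
def stdMonomial {A : Type v} [Ring A] {n : ℕ} (x : Fin n → A) (α : Fin n → ℕ) : A :=
  (List.ofFn fun i => x i ^ α i).prod

/-- `A` is a skew PBW extension of `R` in the elements `x₁, …, xₙ`;
the inclusion `R ⊆ A` is the injective ring homomorphism `ι`. -/
structure IsSkewPBWExtension {R : Type u} {A : Type v} [Ring R] [Ring A] (ι : R →+* A)
    {n : ℕ} (x : Fin n → A) : Prop where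
  /-- `R ⊆ A` -/
  injective : Function.Injective ι
  /-- the standard monomials form a basis of `A` as a left `R`-module: every element of `A` is
  `∑ r_α x^α` for exactly one finitely supported family `(r_α)` -/
  basis : Function.Bijective
    (fun f : (Fin n → ℕ) →₀ R => f.sum fun α r => ι r * stdMonomial x α)
  /-- `x_i r - c_{i,r} x_i ∈ R` with `c_{i,r} ≠ 0` -/
  coeff_comm : ∀ (i : Fin n) (r : R), r ≠ 0 →
    ∃ c : R, c ≠ 0 ∧ ∃ s : R, x i * ι r - ι c * x i = ι s
  /-- `x_j x_i - c_{i,j} x_i x_j ∈ R + R x₁ + ⋯ + R xₙ` with `c_{i,j} ≠ 0` -/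
  var_comm : ∀ i j : Fin n, ∃ c : R, c ≠ 0 ∧ ∃ (s : R) (r : Fin n → R),
    x j * x i - ι c * (x i * x j) = ι s + ∑ t, ι (r t) * x t

/-- Pre-commutative skew PBW extensions: `x_j x_i - c_{i,j} x_i x_j ∈ R x₁ + ⋯ + R xₙ`. -/
structure IsPreCommutative {R : Type u} {A : Type v} [Ring R] [Ring A] (ι : R →+* A)
    {n : ℕ} (x : Fin n → A) : Prop extends IsSkewPBWExtension ι x where
  var_comm_linear : ∀ i j : Fin n, ∃ c : R, c ≠ 0 ∧ ∃ r : Fin n → R,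
    x j * x i - ι c * (x i * x j) = ∑ t, ι (r t) * x t

/-! ### The free algebra `L = K⟨X₁, …, Xₙ⟩` and its quotients -/

/-- `L_m`, the span of the words of length `m` in the free algebra on `n` letters. -/
def wordSpan (K : Type u) [Field K] (n m : ℕ) : Submodule K (FreeAlgebra K (Fin n)) :=
  Submodule.span K {f | ∃ w : List (Fin n), w.length = m ∧ f = (w.map (FreeAlgebra.ι K)).prod}

/-- The quotient `L / ⟨T⟩` of the free algebra by the two-sided ideal generated by `T`. -/
abbrev PresentedAlgebra {K : Type u} [Field K] {n : ℕ} (T : Set (FreeAlgebra K (Fin n))) :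
    Type u :=
  (TwoSidedIdeal.span T).ringCon.Quotient

/-- The projection `L → L / ⟨T⟩`. -/
def toPresented {K : Type u} [Field K] {n : ℕ} (T : Set (FreeAlgebra K (Fin n))) :
    FreeAlgebra K (Fin n) →ₐ[K] PresentedAlgebra T :=
  (TwoSidedIdeal.span T).ringCon.mkₐ K

/-- The degree `m` part of `L / ⟨T⟩` (for `T` homogeneous): the image of `L_m`. -/
def gradedPart {K : Type u} [Field K] {n : ℕ} (T : Set (FreeAlgebra K (Fin n))) (m : ℕ) :
    Submodule K (PresentedAlgebra T) :=
  (wordSpan K n m).map (toPresented T).toLinearMap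

/-- The augmentation `L → K`, `X_i ↦ 0`. -/
def freeAug (K : Type u) [Field K] (n : ℕ) : FreeAlgebra K (Fin n) →ₐ[K] K :=
  FreeAlgebra.lift K (fun _ => (0 : K))

theorem freeAug_eq_zero {K : Type u} [Field K] {n m : ℕ} (hm : m ≠ 0)
    {f : FreeAlgebra K (Fin n)} (hf : f ∈ wordSpan K n m) : freeAug K n f = 0 := by
  have h : wordSpan K n m ≤ LinearMap.ker (freeAug K n).toLinearMap := by
    refine Submodule.span_le.2 ?_
    rintro _ ⟨w, hw, rfl⟩
    cases w with
    | nil => exact absurd hw.symm hm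
    | cons a w => simp [freeAug]
  exact h hf

/-- The augmentation `L / ⟨T⟩ → K` killing the generators, when `T ⊆ L₂`. It makes `K` the
trivial graded module, concentrated in degree `0`, over `L / ⟨T⟩`. -/
def augmentation {K : Type u} [Field K] {n : ℕ} (T : Set (FreeAlgebra K (Fin n)))
    (hT : T ⊆ wordSpan K n 2) : PresentedAlgebra T →ₐ[K] K :=
  RingCon.liftₐ (TwoSidedIdeal.span T).ringCon (freeAug K n) (by
    have h : TwoSidedIdeal.span T ≤ TwoSidedIdeal.ker (freeAug K n) :=
      TwoSidedIdeal.span_le.2 fun f hf =>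
        (TwoSidedIdeal.mem_ker _).2 (freeAug_eq_zero two_ne_zero (hT hf))
    intro a b hab
    have h2 := h ((TwoSidedIdeal.rel_iff _ a b).1 hab)
    rw [TwoSidedIdeal.mem_ker, map_sub, sub_eq_zero] at h2
    exact h2)

/-! ### Koszul algebras -/

/-- The homogeneous quadratic algebra `B = L / ⟨T⟩`, `T ⊆ L₂`, is homogeneous Koszul: the graded
`B`-module `K` has a linear free resolution `⋯ → P₂ → P₁ → P₀ → K → 0`.
Here `P_i = J i →₀ B` is the graded free left module on a set `J i` of generators placed in
degree `i`, so `d i : P_{i+1} → P_i` is homogeneous of degree `0` exactly when it sends the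
generators to combinations of generators with coefficients in `B₁`. The `B`-linear map
`ε : P₀ → K` is semilinear along the augmentation `B → K`. -/
def IsHomogeneousKoszul {K : Type u} [Field K] {n : ℕ} (T : Set (FreeAlgebra K (Fin n))) : Prop :=
  ∃ (hT : T ⊆ wordSpan K n 2) (J : ℕ → Type)
    (d : ∀ i, (J (i + 1) →₀ PresentedAlgebra T) →ₗ[PresentedAlgebra T]
      (J i →₀ PresentedAlgebra T))
    (ε : (J 0 →₀ PresentedAlgebra T) →ₛₗ[(augmentation T hT : PresentedAlgebra T →+* K)] K),
    (∀ (i : ℕ) (j : J (i + 1)) (k : J i), d i (Finsupp.single j 1) k ∈ gradedPart T 1) ∧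
    Function.Surjective ε ∧
    Function.Exact (d 0) ε ∧
    ∀ i, Function.Exact (d (i + 1)) (d i)

/-- The `K`-algebra `B`, with generators `x₁, …, xₙ`, is pre-Koszul with set of relations `S`:
the elements of `S` have the form `∑ c_i X_i + ∑ c_{j,k} X_j X_k`, and `X_i ↦ x_i` induces
`L / ⟨S⟩ ≅ B`. -/
structure IsPreKoszul {K : Type u} [Field K] {B : Type v} [Ring B] [Algebra K B] {n : ℕ}
    (x : Fin n → B) (S : Set (FreeAlgebra K (Fin n))) : Prop where
  subset : S ⊆ (wordSpan K n 1 ⊔ wordSpan K n 2 : Submodule K (FreeAlgebra K (Fin n)))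
  surjective : Function.Surjective (FreeAlgebra.lift K x)
  ker_eq : ∀ f : FreeAlgebra K (Fin n),
    FreeAlgebra.lift K x f = 0 ↔ f ∈ TwoSidedIdeal.span S

/-- The quadratic parts of the elements of `S ⊆ L₁ ⊕ L₂`. -/
def quadraticParts {K : Type u} [Field K] {n : ℕ} (S : Set (FreeAlgebra K (Fin n))) :
    Set (FreeAlgebra K (Fin n)) :=
  {q | q ∈ wordSpan K n 2 ∧ ∃ l ∈ wordSpan K n 1, l + q ∈ S}

/-- `B` is pre-Koszul with relations `S`, and it is Koszul: the associated homogeneous algebra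
`B⁽⁰⁾ = L / ⟨quadratic parts of the elements of S⟩` is homogeneous Koszul. -/
def IsKoszul {K : Type u} [Field K] {B : Type v} [Ring B] [Algebra K B] {n : ℕ}
    (x : Fin n → B) (S : Set (FreeAlgebra K (Fin n))) : Prop :=
  IsPreKoszul x S ∧ IsHomogeneousKoszul (quadraticParts S)

/-- All the relations of the form `∑ c_i X_i + ∑ c_{j,k} X_j X_k` that hold between the elements
`x₁, …, xₙ`. -/
def allRelations (K : Type u) [Field K] {B : Type v} [Ring B] [Algebra K B] {n : ℕ}
    (x : Fin n → B) : Set (FreeAlgebra K (Fin n)) :=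
  {f | f ∈ wordSpan K n 1 ⊔ wordSpan K n 2 ∧ FreeAlgebra.lift K x f = 0}

/-- The relations `X_j X_i - c_{i,j} X_i X_j - ∑ₜ a_{i,j,t} Xₜ`, for all `i` and `j`. -/
def skewRelations {K : Type u} [Field K] {n : ℕ} (c : Fin n → Fin n → K)
    (a : Fin n → Fin n → Fin n → K) : Set (FreeAlgebra K (Fin n)) :=
  {f | ∃ i j : Fin n, f = FreeAlgebra.ι K j * FreeAlgebra.ι K i
    - c i j • (FreeAlgebra.ι K i * FreeAlgebra.ι K j) - ∑ t, a i j t • FreeAlgebra.ι K t}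

/-- The relations `X_j X_i - c_{i,j} X_i X_j`, for all `i` and `j`. -/
def quantumRelations {K : Type u} [Field K] {n : ℕ} (c : Fin n → Fin n → K) :
    Set (FreeAlgebra K (Fin n)) :=
  {f | ∃ i j : Fin n, f = FreeAlgebra.ι K j * FreeAlgebra.ι K i
    - c i j • (FreeAlgebra.ι K i * FreeAlgebra.ι K j)}

end SkewPBW

namespace SkewPBW

universe u v

/-! ### Straightening words into standard monomials. -/

section Words

variable {K : Type u} [Field K] {A : Type v} [Ring A] {n : ℕ}

/-! Everything reduces to the quantum affine space $A^\sigma$. The basis of standard monomials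
forces $c_{ii}=1$ and $c_{ij}c_{ji}=1$ (`coeff_self`, `coeff_mul_coeff`). Any set $S$ between
`skewRelations` and `allRelations` then has two properties. It presents $A$: sorting letters modulo
$S$ reduces every element to standard monomials, and these are independent in $A$
(`isPreKoszul_of_subset`). Its quadratic parts generate the ideal of quantum relations
(`span_quadraticParts_eq`): comparing standard monomials of degree two shows that no relation of $A$
has a quadratic part outside that ideal.

It remains to resolve $K$ over $A^\sigma$. Explicit right multiplication operators on a space with
basis $\mathbb N^n$ show that monomials form a basis, with $x^\beta x_s$ a nonzero multiple of
$x^{\beta+e_s}$ (`exists_quantumBasis`). The resolution is the quantum Koszul complex on generators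
$e_S$, $S\subseteq\{1,\dots,n\}$, whose differential multiplies on the right by the $x_s$, hence is
left linear with coefficients of degree one. Rescaling the monomials $x^\beta e_S$ removes all
twists (`koszulD_monomial`), leaving the classical Koszul complex with signs $\pm1$. Moving the
first occurring variable into the exterior part contracts it (`homotopy_boundary`,
`koszul_homotopy`). -/

theorem stdMonomial_succ (x : Fin (n + 1) → A) (α : Fin (n + 1) → ℕ) :
    stdMonomial x α =
      x 0 ^ α 0 * stdMonomial (fun i => x (Fin.succ i)) (fun i => α (Fin.succ i)) := by
  simp [stdMonomial, List.ofFn_succ]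

theorem stdMonomial_zero (x : Fin n → A) : stdMonomial x 0 = 1 := by
  simp [stdMonomial, List.ofFn_const]

/-- No variable before `x i` occurs, so the product is already in standard order and no commutation
relation is used. -/
theorem mul_stdMonomial (x : Fin n → A) (i : Fin n) (β : Fin n → ℕ) (h : ∀ t < i, β t = 0) :
    x i * stdMonomial x β = stdMonomial x (Pi.single i 1 + β) := by
  induction n with
  | zero => exact i.elim0
  | succ n ih =>
    rw [stdMonomial_succ, stdMonomial_succ]
    refine Fin.cases (fun h => ?_) (fun i h => ?_) i h
    · simp [pow_add, mul_assoc, Fin.succ_ne_zero]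
    · have h0 : β 0 = 0 := h 0 (Fin.succ_pos i)
      have h1 := ih (fun i => x (Fin.succ i)) i (fun i => β (Fin.succ i))
        (fun t ht => h _ (Fin.succ_lt_succ_iff.2 ht))
      simp only [h0, pow_zero, one_mul, h1, Pi.add_apply]
      rw [Pi.single_eq_of_ne (Fin.succ_ne_zero i).symm]
      simp only [add_zero, pow_zero, one_mul]
      congr 1
      funext t
      simp [Pi.single_apply]

theorem stdMonomial_single (x : Fin n → A) (i : Fin n) :
    stdMonomial x (Pi.single i 1) = x i := by
  have h := mul_stdMonomial x i 0 (fun _ _ => rfl)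
  rw [stdMonomial_zero, mul_one, add_zero] at h
  exact h.symm

theorem stdMonomial_pair (x : Fin n → A) {i j : Fin n} (hij : i ≤ j) :
    stdMonomial x (Pi.single i 1 + Pi.single j 1) = x i * x j := by
  rw [← mul_stdMonomial, stdMonomial_single]
  intro t ht
  exact Pi.single_eq_of_ne (ht.trans_le hij).ne _

/-- The value of a word in the elements `x`. -/
def wordProd (x : Fin n → A) (w : List (Fin n)) : A := (w.map x).prod

@[simp] theorem wordProd_nil (x : Fin n → A) : wordProd x [] = 1 := rfl

@[simp] theorem wordProd_cons (x : Fin n → A) (i : Fin n) (w : List (Fin n)) :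
    wordProd x (i :: w) = x i * wordProd x w := by simp [wordProd]

theorem wordProd_append (x : Fin n → A) (w w' : List (Fin n)) :
    wordProd x (w ++ w') = wordProd x w * wordProd x w' := by simp [wordProd]

/-- The standard word with the given letter counts. -/
def stdWord (β : Fin n → ℕ) : List (Fin n) :=
  (List.ofFn fun i => List.replicate (β i) i).flatten

theorem wordProd_stdWord (x : Fin n → A) (β : Fin n → ℕ) :
    wordProd x (stdWord β) = stdMonomial x β := by
  simp [wordProd, stdWord, stdMonomial, List.map_flatten, List.prod_flatten, List.map_ofFn,
    Function.comp_def]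

theorem count_stdWord (β : Fin n → ℕ) (i : Fin n) : (stdWord β).count i = β i := by
  simp [stdWord, List.count_flatten, List.map_ofFn, List.sum_ofFn, List.count_replicate]

theorem perm_stdWord (w : List (Fin n)) : w.Perm (stdWord fun i => w.count i) :=
  List.perm_iff_count.2 fun i => (count_stdWord (fun i => w.count i) i).symm

variable (K) [Algebra K A]

/-- The span of the words of length less than `d`. -/
def shortWords (x : Fin n → A) (d : ℕ) : Submodule K A :=
  Submodule.span K {f | ∃ w : List (Fin n), w.length < d ∧ f = wordProd x w}

variable {K}

theorem wordProd_mem_shortWords (x : Fin n → A) {w : List (Fin n)} {d : ℕ} (h : w.length < d) :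
    wordProd x w ∈ shortWords K x d := Submodule.subset_span ⟨w, h, rfl⟩

theorem mul_mem_shortWords (x : Fin n → A) (i : Fin n) {d : ℕ} {f : A}
    (hf : f ∈ shortWords K x d) : x i * f ∈ shortWords K x (d + 1) := by
  have h : shortWords K x d ≤ (shortWords K x (d + 1)).comap (LinearMap.mulLeft K (x i)) := by
    refine Submodule.span_le.2 ?_
    rintro _ ⟨w, hw, rfl⟩
    have : wordProd x (i :: w) ∈ shortWords K x (d + 1) :=
      wordProd_mem_shortWords x (by simpa using hw)
    simpa using this
  exact h hf

/-- Permuting the letters of a word changes it, up to a scalar, by shorter words. -/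
theorem wordProd_perm (x : Fin n → A) (c : Fin n → Fin n → K)
    (hx : ∀ i j, x j * x i - c i j • (x i * x j) ∈ Submodule.span K (Set.range x))
    {w w' : List (Fin n)} (h : w.Perm w') :
    ∃ k : K, wordProd x w - k • wordProd x w' ∈ shortWords K x w.length := by
  induction h with
  | nil => exact ⟨1, by simp⟩
  | cons i h ih =>
    obtain ⟨k, hk⟩ := ih
    refine ⟨k, ?_⟩
    have := mul_mem_shortWords x i hk
    rwa [mul_sub, mul_smul_comm, ← wordProd_cons, ← wordProd_cons] at this
  | swap i j l =>
    refine ⟨c i j, ?_⟩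
    -- The linear terms of the commutation relation, multiplied by the tail `l`, give words one
    -- letter shorter than the original.
    have h : Submodule.span K (Set.range x) ≤
        (shortWords K x (l.length + 2)).comap (LinearMap.mulRight K (wordProd x l)) := by
      refine Submodule.span_le.2 ?_
      rintro _ ⟨t, rfl⟩
      have : wordProd x (t :: l) ∈ shortWords K x (l.length + 2) :=
        wordProd_mem_shortWords x (by simp)
      simpa using this
    have h2 := h (hx i j)
    simp only [Submodule.mem_comap, LinearMap.mulRight_apply, sub_mul, smul_mul_assoc,
      mul_assoc] at h2
    simpa using h2
  | trans h₁ h₂ ih₁ ih₂ =>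
    obtain ⟨k₁, hk₁⟩ := ih₁
    obtain ⟨k₂, hk₂⟩ := ih₂
    refine ⟨k₁ * k₂, ?_⟩
    rw [← h₁.length_eq] at hk₂
    have := add_mem hk₁ (Submodule.smul_mem _ k₁ hk₂)
    rwa [smul_sub, smul_smul, sub_add_sub_cancel] at this

/-- Sorting the letters gives a multiple of a standard monomial plus shorter words, to which
induction on the length applies. -/
theorem wordProd_mem_span_stdMonomial (x : Fin n → A) (c : Fin n → Fin n → K)
    (hx : ∀ i j, x j * x i - c i j • (x i * x j) ∈ Submodule.span K (Set.range x))
    (w : List (Fin n)) : wordProd x w ∈ Submodule.span K (Set.range (stdMonomial x)) := by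
  induction hd : w.length using Nat.strong_induction_on generalizing w with
  | _ d ih =>
    obtain ⟨k, hk⟩ := wordProd_perm x c hx (perm_stdWord w)
    have h1 : shortWords K x w.length ≤ Submodule.span K (Set.range (stdMonomial x)) := by
      refine Submodule.span_le.2 ?_
      rintro _ ⟨w', hw', rfl⟩
      exact ih _ (hd ▸ hw') w' rfl
    have h2 : k • wordProd x (stdWord fun i => w.count i) ∈
        Submodule.span K (Set.range (stdMonomial x)) := by
      rw [wordProd_stdWord]
      exact Submodule.smul_mem _ _ (Submodule.subset_span ⟨_, rfl⟩)
    simpa using add_mem (h1 hk) h2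

theorem lift_wordProd (x : Fin n → A) (w : List (Fin n)) :
    FreeAlgebra.lift K x (wordProd (FreeAlgebra.ι K) w) = wordProd x w := by
  simp [wordProd, map_list_prod, Function.comp_def]

theorem lift_stdMonomial (x : Fin n → A) (β : Fin n → ℕ) :
    FreeAlgebra.lift K x (stdMonomial (FreeAlgebra.ι K) β) = stdMonomial x β := by
  rw [← wordProd_stdWord, lift_wordProd, wordProd_stdWord]

theorem span_wordProd (K : Type u) [Field K] (n : ℕ) :
    Submodule.span K (Set.range (wordProd (FreeAlgebra.ι K (X := Fin n)))) = ⊤ := by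
  refine Submodule.eq_top_iff'.2 fun f => ?_
  induction f using FreeAlgebra.induction with
  | grade0 r =>
    rw [Algebra.algebraMap_eq_smul_one]
    exact Submodule.smul_mem _ _ (Submodule.subset_span ⟨[], rfl⟩)
  | grade1 i => exact Submodule.subset_span ⟨[i], by simp⟩
  | add a b ha hb => exact add_mem ha hb
  | mul a b ha hb =>
    refine Submodule.span_induction₂ (p := fun a b _ _ => a * b ∈ _) ?_ ?_ ?_ ?_ ?_ ?_ ?_ ha hb
    · rintro _ _ ⟨w, rfl⟩ ⟨w', rfl⟩
      exact Submodule.subset_span ⟨w ++ w', wordProd_append _ _ _⟩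
    · intro y _; simp
    · intro y _; simp
    · intro x y z _ _ _ h h'; rw [add_mul]; exact add_mem h h'
    · intro x y z _ _ _ h h'; rw [mul_add]; exact add_mem h h'
    · intro r x y _ _ h; rw [smul_mul_assoc]; exact Submodule.smul_mem _ _ h
    · intro r x y _ _ h; rw [mul_smul_comm]; exact Submodule.smul_mem _ _ h

/-- The standard monomials span the image of the free algebra. -/
theorem lift_mem_span_stdMonomial (x : Fin n → A) (c : Fin n → Fin n → K)
    (hx : ∀ i j, x j * x i - c i j • (x i * x j) ∈ Submodule.span K (Set.range x))
    (f : FreeAlgebra K (Fin n)) :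
    FreeAlgebra.lift K x f ∈ Submodule.span K (Set.range (stdMonomial x)) := by
  have h : (⊤ : Submodule K (FreeAlgebra K (Fin n))) ≤
      (Submodule.span K (Set.range (stdMonomial x))).comap
        (FreeAlgebra.lift K x).toLinearMap := by
    rw [← span_wordProd, Submodule.span_le]
    rintro _ ⟨w, rfl⟩
    simpa [lift_wordProd] using wordProd_mem_span_stdMonomial x c hx w
  exact h trivial

end Words

/-! ### The structure constants, the quadratic parts and the presentation of `A`. -/

section Presentations

variable {K : Type u} [Field K] {n : ℕ}

theorem toPresented_eq_zero {T : Set (FreeAlgebra K (Fin n))} {f : FreeAlgebra K (Fin n)} :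
    toPresented T f = 0 ↔ f ∈ TwoSidedIdeal.span T := by
  rw [TwoSidedIdeal.mem_iff, ← map_zero (toPresented T)]
  exact (TwoSidedIdeal.span T).ringCon.eq

theorem toPresented_surjective (T : Set (FreeAlgebra K (Fin n))) :
    Function.Surjective (toPresented T) := fun b =>
  Quotient.inductionOn' b fun f => ⟨f, rfl⟩

theorem toPresented_eq_lift (T : Set (FreeAlgebra K (Fin n))) :
    toPresented T = FreeAlgebra.lift K (fun i => toPresented T (FreeAlgebra.ι K i)) := by
  ext i
  simp

theorem ι_mem_wordSpan (i : Fin n) : FreeAlgebra.ι K i ∈ wordSpan K n 1 :=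
  Submodule.subset_span ⟨[i], rfl, by simp⟩

theorem ι_mul_ι_mem_wordSpan (i j : Fin n) :
    FreeAlgebra.ι K i * FreeAlgebra.ι K j ∈ wordSpan K n 2 :=
  Submodule.subset_span ⟨[i, j], rfl, by simp⟩

theorem wordSpan_one_le (N : Submodule K (FreeAlgebra K (Fin n)))
    (h : ∀ i, FreeAlgebra.ι K i ∈ N) : wordSpan K n 1 ≤ N := by
  refine Submodule.span_le.2 ?_
  rintro _ ⟨w, hw, rfl⟩
  obtain ⟨i, rfl⟩ := List.length_eq_one_iff.1 hw
  simpa using h i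

theorem wordSpan_two_le (N : Submodule K (FreeAlgebra K (Fin n)))
    (h : ∀ i j, FreeAlgebra.ι K i * FreeAlgebra.ι K j ∈ N) : wordSpan K n 2 ≤ N := by
  refine Submodule.span_le.2 ?_
  rintro _ ⟨w, hw, rfl⟩
  obtain ⟨i, j, rfl⟩ := List.length_eq_two.1 hw
  simpa using h i j

variable {A : Type v} [Ring A] [Algebra K A]

/-- The basis of standard monomials of a skew PBW extension of a field. -/
noncomputable def stdBasis (x : Fin n → A)
    (hA : IsSkewPBWExtension (algebraMap K A) x) : Module.Basis (Fin n → ℕ) K A :=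
  Module.Basis.ofRepr (LinearEquiv.ofBijective (Finsupp.linearCombination K (stdMonomial x)) (by
    have h := hA.basis
    simp only [← Algebra.smul_def] at h
    exact h)).symm

theorem stdBasis_apply (x : Fin n → A) (hA : IsSkewPBWExtension (algebraMap K A) x)
    (β : Fin n → ℕ) : stdBasis x hA β = stdMonomial x β := by
  simp only [stdBasis, Module.Basis.coe_ofRepr, LinearEquiv.symm_symm]
  exact (Finsupp.linearCombination_single K 1 β).trans (one_smul _ _)

theorem sum_single_ne (i j t : Fin n) :
    (Pi.single t 1 : Fin n → ℕ) ≠ Pi.single i 1 + Pi.single j 1 := by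
  intro h
  have := congrArg (fun f : Fin n → ℕ => ∑ k, f k) h
  simp [Finset.sum_add_distrib] at this

theorem repr_pair_eq_zero (x : Fin n → A) (hA : IsSkewPBWExtension (algebraMap K A) x)
    (i j : Fin n) {f : A} (hf : f ∈ Submodule.span K (Set.range x)) :
    (stdBasis x hA).repr f (Pi.single i 1 + Pi.single j 1) = 0 := by
  have h : Submodule.span K (Set.range x) ≤
      LinearMap.ker ((stdBasis x hA).coord (Pi.single i 1 + Pi.single j 1)) := by
    refine Submodule.span_le.2 ?_
    rintro _ ⟨t, rfl⟩
    rw [← stdMonomial_single x t, ← stdBasis_apply x hA]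
    simp [sum_single_ne]
  exact h hf

theorem smul_pair_mem_span (x : Fin n → A) (hA : IsSkewPBWExtension (algebraMap K A) x)
    {i j : Fin n} (hij : i ≤ j) {k : K} (hf : k • (x i * x j) ∈ Submodule.span K (Set.range x)) :
    k = 0 := by
  have h := repr_pair_eq_zero x hA i j hf
  rw [← stdMonomial_pair x hij, ← stdBasis_apply x hA] at h
  simpa using h

theorem coeff_self (x : Fin n → A) (hA : IsSkewPBWExtension (algebraMap K A) x)
    {c : Fin n → Fin n → K}
    (hx : ∀ i j, x j * x i - c i j • (x i * x j) ∈ Submodule.span K (Set.range x)) (i : Fin n) :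
    c i i = 1 := by
  have h := hx i i
  rw [← one_smul K (x i * x i), smul_smul, mul_one, ← sub_smul] at h
  exact (sub_eq_zero.1 (smul_pair_mem_span x hA le_rfl h)).symm

/-- Swapping two variables twice returns the same product up to linear terms; for `i ≤ j` it is a
standard monomial of degree two, independent of the variables. -/
theorem coeff_mul_coeff (x : Fin n → A) (hA : IsSkewPBWExtension (algebraMap K A) x)
    {c : Fin n → Fin n → K}
    (hx : ∀ i j, x j * x i - c i j • (x i * x j) ∈ Submodule.span K (Set.range x))
    (i j : Fin n) : c i j * c j i = 1 := by
  wlog hij : i ≤ j generalizing i j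
  · rw [mul_comm]; exact this j i (le_of_not_ge hij)
  have h : (1 - c i j * c j i) • (x i * x j) ∈ Submodule.span K (Set.range x) := by
    have := add_mem (hx j i) (Submodule.smul_mem _ (c j i) (hx i j))
    convert this using 1
    rw [smul_sub, smul_smul, sub_smul, one_smul, mul_comm]
    abel
  exact (sub_eq_zero.1 (smul_pair_mem_span x hA hij h)).symm

theorem quantumRelations_subset (c : Fin n → Fin n → K) :
    quantumRelations c ⊆ wordSpan K n 2 := by
  rintro _ ⟨i, j, rfl⟩
  exact sub_mem (ι_mul_ι_mem_wordSpan _ _) (Submodule.smul_mem _ _ (ι_mul_ι_mem_wordSpan _ _))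

theorem quantum_comm {c : Fin n → Fin n → K} {T : Set (FreeAlgebra K (Fin n))}
    (hT : quantumRelations c ⊆ TwoSidedIdeal.span T) (i j : Fin n) :
    toPresented T (FreeAlgebra.ι K j) * toPresented T (FreeAlgebra.ι K i) =
      c i j • (toPresented T (FreeAlgebra.ι K i) * toPresented T (FreeAlgebra.ι K j)) := by
  have h := toPresented_eq_zero.2 (hT ⟨i, j, rfl⟩)
  simpa [sub_eq_zero] using h

/-- The quadratic parts of the relations of `A` vanish in the quantum affine space. -/
theorem quadraticParts_allRelations_subset (x : Fin n → A)
    (hA : IsSkewPBWExtension (algebraMap K A) x) {c : Fin n → Fin n → K}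
    (hx : ∀ i j, x j * x i - c i j • (x i * x j) ∈ Submodule.span K (Set.range x)) :
    quadraticParts (allRelations K x) ⊆ TwoSidedIdeal.span (quantumRelations c) := by
  classical
  rintro q ⟨hq, l, hl, -, hlq⟩
  set T := quantumRelations c
  let y : Fin n → PresentedAlgebra T := fun i => toPresented T (FreeAlgebra.ι K i)
  -- `Ψ` extracts the part of degree two. It is only linear, but on products of two variables it
  -- agrees with the projection to the quantum space. Applied to the relation `l + q`, it leaves the
  -- class of `q`.
  let Ψ : A →ₗ[K] PresentedAlgebra T := (stdBasis x hA).constr K fun β =>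
    if ∑ i, β i = 2 then stdMonomial y β else 0
  have hΨ (β : Fin n → ℕ) :
      Ψ (stdMonomial x β) = if ∑ i, β i = 2 then stdMonomial y β else 0 := by
    rw [← stdBasis_apply x hA]
    exact Module.Basis.constr_basis _ _ _ _
  have hΨ1 (t : Fin n) : Ψ (x t) = 0 := by
    rw [← stdMonomial_single x t, hΨ, if_neg (by simp)]
  have hΨspan {f : A} (hf : f ∈ Submodule.span K (Set.range x)) : Ψ f = 0 := by
    have h : Submodule.span K (Set.range x) ≤ LinearMap.ker Ψ := by
      refine Submodule.span_le.2 ?_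
      rintro _ ⟨t, rfl⟩
      exact hΨ1 t
    exact h hf
  have hΨ2 {i j : Fin n} (hij : i ≤ j) : Ψ (x i * x j) = y i * y j := by
    rw [← stdMonomial_pair x hij, hΨ, if_pos (by simp [Finset.sum_add_distrib]),
      stdMonomial_pair y hij]
  have hΨ3 (i j : Fin n) : Ψ (x i * x j) = y i * y j := by
    rcases le_total i j with hij | hij
    · exact hΨ2 hij
    · have h := hΨspan (hx j i)
      rw [map_sub, map_smul, hΨ2 hij, sub_eq_zero] at h
      rw [h]
      exact (quantum_comm (fun f hf => TwoSidedIdeal.subset_span hf) j i).symm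
  have e1 : Ψ (FreeAlgebra.lift K x l) = 0 :=
    wordSpan_one_le (LinearMap.ker (Ψ ∘ₗ (FreeAlgebra.lift K x).toLinearMap))
      (fun i => by simpa using hΨ1 i) hl
  have e2 : Ψ (FreeAlgebra.lift K x q) = toPresented T q :=
    wordSpan_two_le
      (LinearMap.eqLocus (Ψ ∘ₗ (FreeAlgebra.lift K x).toLinearMap) (toPresented T).toLinearMap)
      (fun i j => by simpa using hΨ3 i j) hq
  have h := congrArg Ψ hlq
  rw [map_add, map_add, e1, e2, zero_add, map_zero] at h
  exact toPresented_eq_zero.1 h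

theorem skewRelations_subset_allRelations {x : Fin n → A} {c : Fin n → Fin n → K}
    {a : Fin n → Fin n → Fin n → K}
    (hx : ∀ i j, x j * x i - c i j • (x i * x j) = ∑ t, a i j t • x t) :
    skewRelations c a ⊆ allRelations K x := by
  rintro _ ⟨i, j, rfl⟩
  refine ⟨sub_mem (Submodule.mem_sup_right (quantumRelations_subset c ⟨i, j, rfl⟩))
    (Submodule.mem_sup_left (sum_mem fun t _ => Submodule.smul_mem _ _ (ι_mem_wordSpan t))), ?_⟩
  simp [hx]

theorem quantumRelations_subset_quadraticParts (c : Fin n → Fin n → K)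
    (a : Fin n → Fin n → Fin n → K) :
    quantumRelations c ⊆ quadraticParts (skewRelations c a) := by
  rintro _ ⟨i, j, rfl⟩
  refine ⟨quantumRelations_subset c ⟨i, j, rfl⟩, -∑ t, a i j t • FreeAlgebra.ι K t,
    neg_mem (sum_mem fun t _ => Submodule.smul_mem _ _ (ι_mem_wordSpan t)), i, j, ?_⟩
  abel

theorem quadraticParts_mono {S S' : Set (FreeAlgebra K (Fin n))} (h : S ⊆ S') :
    quadraticParts S ⊆ quadraticParts S' :=
  fun _ ⟨hq, l, hl, hlq⟩ => ⟨hq, l, hl, h hlq⟩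

/-- Both ends of the sandwich give the same ideal, so one argument serves for `skewRelations` and
`allRelations`. -/
theorem span_quadraticParts_eq (x : Fin n → A) (hA : IsSkewPBWExtension (algebraMap K A) x)
    {c : Fin n → Fin n → K} {a : Fin n → Fin n → Fin n → K}
    (hx : ∀ i j, x j * x i - c i j • (x i * x j) = ∑ t, a i j t • x t)
    {S : Set (FreeAlgebra K (Fin n))} (h₁ : skewRelations c a ⊆ S) (h₂ : S ⊆ allRelations K x) :
    TwoSidedIdeal.span (quadraticParts S) = TwoSidedIdeal.span (quantumRelations c) := by
  apply le_antisymm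
  · refine TwoSidedIdeal.span_le.2
      ((quadraticParts_mono h₂).trans (quadraticParts_allRelations_subset x hA fun i j => ?_))
    rw [hx]
    exact sum_mem fun t _ => Submodule.smul_mem _ _ (Submodule.subset_span ⟨t, rfl⟩)
  · exact TwoSidedIdeal.span_mono
      ((quantumRelations_subset_quadraticParts c a).trans (quadraticParts_mono h₁))

/-- Straightening shows that the skew commutation relations present `A`. -/
theorem isPreKoszul_of_subset (x : Fin n → A) (hA : IsSkewPBWExtension (algebraMap K A) x)
    {c : Fin n → Fin n → K} {a : Fin n → Fin n → Fin n → K}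
    {S : Set (FreeAlgebra K (Fin n))} (h₁ : skewRelations c a ⊆ S) (h₂ : S ⊆ allRelations K x) :
    IsPreKoszul x S where
  subset := fun f hf => (h₂ hf).1
  surjective := by
    have hr : (⊤ : Submodule K A) ≤ LinearMap.range (FreeAlgebra.lift K x).toLinearMap := by
      rw [← (stdBasis x hA).span_eq, Submodule.span_le]
      rintro _ ⟨β, rfl⟩
      rw [stdBasis_apply]
      exact ⟨_, lift_stdMonomial x β⟩
    intro b
    exact hr (Submodule.mem_top (x := b))
  ker_eq := by
    have hle : TwoSidedIdeal.span S ≤ TwoSidedIdeal.ker (FreeAlgebra.lift K x) :=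
      TwoSidedIdeal.span_le.2 fun f hf => (TwoSidedIdeal.mem_ker _).2 (h₂ hf).2
    intro f
    refine ⟨fun hf => ?_, fun hf => (TwoSidedIdeal.mem_ker _).1 (hle hf)⟩
    let y : Fin n → PresentedAlgebra S := fun i => toPresented S (FreeAlgebra.ι K i)
    have hy (i j : Fin n) : y j * y i - c i j • (y i * y j) ∈
        Submodule.span K (Set.range y) := by
      have h := toPresented_eq_zero.2 (TwoSidedIdeal.subset_span (h₁ ⟨i, j, rfl⟩))
      simp only [map_sub, map_mul, map_smul, map_sum, sub_eq_zero] at h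
      rw [h]
      exact sum_mem fun t _ => Submodule.smul_mem _ _ (Submodule.subset_span ⟨t, rfl⟩)
    have hker : ∀ b : PresentedAlgebra S, ∃ g : (Fin n → ℕ) →₀ K,
        b = Finsupp.linearCombination K (stdMonomial y) g := by
      intro b
      obtain ⟨g, rfl⟩ := toPresented_surjective S b
      have h := lift_mem_span_stdMonomial y c hy g
      rw [← toPresented_eq_lift] at h
      obtain ⟨k, hk⟩ := (Finsupp.mem_span_range_iff_exists_finsupp).1 h
      exact ⟨k, hk.symm⟩
    obtain ⟨g, hg⟩ := hker (toPresented S f)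
    -- `F` is a normal form of `f` modulo `S`. If `f` vanishes in `A`, so does `F`, and independence
    -- in `A` makes all its coefficients zero.
    let F : FreeAlgebra K (Fin n) := Finsupp.linearCombination K
      (stdMonomial (FreeAlgebra.ι K)) g
    have hF : toPresented S F = Finsupp.linearCombination K (stdMonomial y) g := by
      rw [toPresented_eq_lift]
      simp only [F, Finsupp.linearCombination_apply, Finsupp.sum, map_sum, map_smul,
        lift_stdMonomial]
      rfl
    have hFx : FreeAlgebra.lift K x F = Finsupp.linearCombination K (stdBasis x hA) g := by
      simp only [F, Finsupp.linearCombination_apply, Finsupp.sum, map_sum, map_smul,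
        lift_stdMonomial, stdBasis_apply]
    have h0 : FreeAlgebra.lift K x (f - F) = 0 := (TwoSidedIdeal.mem_ker _).1
      (hle (toPresented_eq_zero.1 (by rw [map_sub, hg, hF, sub_self])))
    rw [map_sub, hf, zero_sub, neg_eq_zero, hFx] at h0
    have hg0 : g = 0 := linearIndependent_iff.1 (stdBasis x hA).linearIndependent g h0
    rw [hg0, map_zero] at hg
    exact toPresented_eq_zero.1 hg

end Presentations

/-! ### The monomial basis of the quantum affine space. -/

section QuantumSpace

variable {K : Type u} [Field K] {n : ℕ}

/-- The scalar that appears when `x_s` is moved into its place in `x^β x_s`. -/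
def twist (c : Fin n → Fin n → K) (β : Fin n → ℕ) (s : Fin n) : K :=
  ∏ i, (if s < i then c s i else 1) ^ β i

theorem twist_add (c : Fin n → Fin n → K) (β γ : Fin n → ℕ) (s : Fin n) :
    twist c (β + γ) s = twist c β s * twist c γ s := by
  simp only [twist, Pi.add_apply, pow_add, Finset.prod_mul_distrib]

theorem twist_single (c : Fin n → Fin n → K) (t s : Fin n) :
    twist c (Pi.single t 1) s = if s < t then c s t else 1 := by
  rw [twist, Finset.prod_eq_single t]
  · simp
  · intro i _ hi
    simp [hi]
  · simp

theorem twist_ne_zero {c : Fin n → Fin n → K} (hc : ∀ i j, c i j ≠ 0) (β : Fin n → ℕ)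
    (s : Fin n) : twist c β s ≠ 0 := by
  refine Finset.prod_ne_zero_iff.2 fun i _ => pow_ne_zero _ ?_
  split_ifs
  exacts [hc _ _, one_ne_zero]

/-- This identity is what makes the operators `rightOp` satisfy the quantum relations. -/
theorem twist_comm {c : Fin n → Fin n → K} (hc : ∀ i j, c i j * c j i = 1)
    (hc' : ∀ i, c i i = 1) (i j : Fin n) :
    twist c (Pi.single j 1) i = c i j * twist c (Pi.single i 1) j := by
  rw [twist_single, twist_single]
  rcases lt_trichotomy i j with h | rfl | h
  · simp [h, h.not_gt]
  · simp [hc']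
  · simp [h, h.not_gt, hc]

/-- Right multiplication by `x_s` on the standard monomials of the quantum affine space. -/
noncomputable def rightOp (c : Fin n → Fin n → K) (s : Fin n) :
    Module.End K ((Fin n → ℕ) →₀ K) :=
  Finsupp.linearCombination K fun β => twist c β s • Finsupp.single (β + Pi.single s 1) 1

theorem rightOp_single (c : Fin n → Fin n → K) (s : Fin n) (β : Fin n → ℕ) :
    rightOp c s (Finsupp.single β 1) =
      twist c β s • Finsupp.single (β + Pi.single s 1) 1 := by
  simp [rightOp]

theorem rightOp_comm {c : Fin n → Fin n → K} (hc : ∀ i j, c i j * c j i = 1)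
    (hc' : ∀ i, c i i = 1) (i j : Fin n) :
    rightOp c i * rightOp c j = c i j • (rightOp c j * rightOp c i) := by
  refine Finsupp.basisSingleOne.ext fun β => ?_
  simp only [Finsupp.coe_basisSingleOne, Module.End.mul_apply, LinearMap.smul_apply,
    rightOp_single, map_smul, smul_smul, twist_add, twist_comm hc hc' i j]
  rw [add_right_comm]
  congr 1
  ring

/-- The right regular representation of the quantum affine space. -/
noncomputable def rightRep (c : Fin n → Fin n → K) :
    FreeAlgebra K (Fin n) →ₐ[K] (Module.End K ((Fin n → ℕ) →₀ K))ᵐᵒᵖ :=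
  FreeAlgebra.lift K fun s => MulOpposite.op (rightOp c s)

theorem rightRep_eq_zero {c : Fin n → Fin n → K} (hc : ∀ i j, c i j * c j i = 1)
    (hc' : ∀ i, c i i = 1) {f : FreeAlgebra K (Fin n)}
    (hf : f ∈ TwoSidedIdeal.span (quantumRelations c)) : rightRep c f = 0 := by
  have h : TwoSidedIdeal.span (quantumRelations c) ≤ TwoSidedIdeal.ker (rightRep c) := by
    refine TwoSidedIdeal.span_le.2 ?_
    rintro _ ⟨i, j, rfl⟩
    refine (TwoSidedIdeal.mem_ker _).2 ?_
    simp [rightRep, ← MulOpposite.op_mul, ← MulOpposite.op_smul, rightOp_comm hc hc' i j]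
  exact (TwoSidedIdeal.mem_ker _).1 (h hf)

/-- The action on `1`. -/
noncomputable def actOne (c : Fin n → Fin n → K) :
    FreeAlgebra K (Fin n) →ₗ[K] ((Fin n → ℕ) →₀ K) :=
  LinearMap.applyₗ (Finsupp.single 0 1) ∘ₗ
    (MulOpposite.opLinearEquiv K).symm.toLinearMap ∘ₗ (rightRep c).toLinearMap

theorem actOne_apply (c : Fin n → Fin n → K) (f : FreeAlgebra K (Fin n)) :
    actOne c f = (rightRep c f).unop (Finsupp.single 0 1) := rfl

theorem actOne_mul_ι (c : Fin n → Fin n → K) (f : FreeAlgebra K (Fin n)) (s : Fin n) :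
    actOne c (f * FreeAlgebra.ι K s) = rightOp c s (actOne c f) := by
  simp [actOne_apply, rightRep]

/-- Each letter acts by shifting the exponent and multiplying by a nonzero twist. This separates
standard monomials with different exponents. -/
theorem actOne_wordProd {c : Fin n → Fin n → K} (hc : ∀ i j, c i j ≠ 0) (w : List (Fin n)) :
    ∃ k : K, k ≠ 0 ∧ actOne c (wordProd (FreeAlgebra.ι K) w) =
      k • Finsupp.single (fun i => w.count i) 1 := by
  induction w using List.reverseRecOn with
  | nil => exact ⟨1, one_ne_zero, by simp [actOne_apply]; rfl⟩
  | append_singleton w s ih =>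
    obtain ⟨k, hk, h⟩ := ih
    refine ⟨k * twist c (fun i => w.count i) s, mul_ne_zero hk (twist_ne_zero hc _ _), ?_⟩
    rw [wordProd_append, wordProd_cons, wordProd_nil, mul_one, actOne_mul_ι, h, map_smul,
      rightOp_single, smul_smul]
    congr 2
    funext i
    by_cases h : s = i
    · subst h; simp
    · simp [h, Ne.symm h]

/-- Monomials form a basis of the quantum affine space. -/
theorem exists_quantumBasis {c : Fin n → Fin n → K} (hc : ∀ i j, c i j * c j i = 1)
    (hc' : ∀ i, c i i = 1) {T : Set (FreeAlgebra K (Fin n))}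
    (hT : TwoSidedIdeal.span T = TwoSidedIdeal.span (quantumRelations c)) :
    ∃ b : Module.Basis (Fin n → ℕ) K (PresentedAlgebra T), b 0 = 1 ∧
      ∀ β s, b β * toPresented T (FreeAlgebra.ι K s) =
        twist c β s • b (β + Pi.single s 1) := by
  have hc0 (i j : Fin n) : c i j ≠ 0 := left_ne_zero_of_mul_eq_one (hc i j)
  let y : Fin n → PresentedAlgebra T := fun i => toPresented T (FreeAlgebra.ι K i)
  have hy (i j : Fin n) : y j * y i - c i j • (y i * y j) ∈
      Submodule.span K (Set.range y) := by
    rw [quantum_comm (by rw [hT]; exact TwoSidedIdeal.subset_span), sub_self]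
    exact zero_mem _
  have hφ (β : Fin n → ℕ) : ∃ k : K, k ≠ 0 ∧
      actOne c (stdMonomial (FreeAlgebra.ι K) β) = k • Finsupp.single β 1 := by
    have h := actOne_wordProd hc0 (stdWord β)
    simpa only [count_stdWord, wordProd_stdWord] using h
  choose k hk0 hk using hφ
  have hker {f : FreeAlgebra K (Fin n)} (hf : toPresented T f = 0) : actOne c f = 0 := by
    rw [toPresented_eq_zero, hT] at hf
    rw [actOne_apply, rightRep_eq_zero hc hc' hf]
    rfl
  -- Normalized so that `actOne` sends `g β` exactly to the basis vector at `β`; only `k β ≠ 0` is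
  -- needed.
  let g (β : Fin n → ℕ) : FreeAlgebra K (Fin n) :=
    (k β)⁻¹ • stdMonomial (FreeAlgebra.ι K) β
  have hg (β : Fin n → ℕ) : actOne c (g β) = Finsupp.single β 1 := by
    simp only [g, map_smul, hk, smul_smul, inv_mul_cancel₀ (hk0 β), one_smul]
  have hspan : Submodule.span K (Set.range (stdMonomial y)) ≤
      Submodule.span K (Set.range fun β => toPresented T (g β)) := by
    refine Submodule.span_le.2 ?_
    rintro _ ⟨β, rfl⟩
    have : stdMonomial y β = k β • toPresented T (g β) := by
      rw [← map_smul, smul_smul, mul_inv_cancel₀ (hk0 β), one_smul, toPresented_eq_lift,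
        lift_stdMonomial]
    rw [this]
    exact Submodule.smul_mem _ _ (Submodule.subset_span ⟨β, rfl⟩)
  have hli : LinearIndependent K fun β => toPresented T (g β) := by
    refine linearIndependent_iff.2 fun l hl => ?_
    have h1 : toPresented T (Finsupp.linearCombination K g l) = 0 := by
      rw [← hl]
      simp [Finsupp.linearCombination_apply, Finsupp.sum, map_sum]
    have h2 := hker h1
    rw [Finsupp.linearCombination_apply, map_finsuppSum] at h2
    simpa [hg] using h2
  let b := Module.Basis.mk hli (fun z _ => by
    obtain ⟨f, rfl⟩ := toPresented_surjective T z
    have h := lift_mem_span_stdMonomial y c hy f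
    rw [← toPresented_eq_lift] at h
    exact hspan h)
  have hb (β : Fin n → ℕ) : b β = toPresented T (g β) := Module.Basis.mk_apply _ _ _
  -- `actOne` computes the coordinates in the basis `b`, so identities in the quotient can be
  -- checked on the explicit operators.
  have hinj {f f' : FreeAlgebra K (Fin n)} (h : actOne c f = actOne c f') :
      toPresented T f = toPresented T f' := by
    have key (f : FreeAlgebra K (Fin n)) :
        toPresented T f = Finsupp.linearCombination K b (actOne c f) := by
      have e : toPresented T f =
          toPresented T (Finsupp.linearCombination K g (b.repr (toPresented T f))) := by
        conv_lhs => rw [← b.linearCombination_repr (toPresented T f)]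
        simp [Finsupp.linearCombination_apply, Finsupp.sum, map_sum, hb]
      have e2 := hker (f := f - Finsupp.linearCombination K g (b.repr (toPresented T f)))
        (by rw [map_sub, ← e, sub_self])
      rw [map_sub, sub_eq_zero, Finsupp.linearCombination_apply, map_finsuppSum] at e2
      have e3 : actOne c f = b.repr (toPresented T f) := by
        rw [e2]
        simp [hg]
      rw [e3, b.linearCombination_repr]
    rw [key, key, h]
  refine ⟨b, ?_, fun β s => ?_⟩
  · rw [hb, ← map_one (toPresented T)]
    apply hinj
    rw [hg, actOne_apply, map_one]
    rfl
  · rw [hb, hb, ← map_mul, ← map_smul]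
    apply hinj
    rw [actOne_mul_ι, hg, rightOp_single, map_smul, hg]

end QuantumSpace

/-! ### Combinatorics of the Koszul complex on formal generators. -/

section KoszulComplex

variable {n : ℕ}

/-- The Koszul sign of removing `s` from `S`. -/
def koszulSign (s : Fin n) (S : Finset (Fin n)) : ℤ := (-1) ^ (S.filter (· < s)).card

/-- Removing the larger index `s` does not affect the count below `t`, while removing `t` lowers the
count below `s` by one. -/
theorem koszulSign_swap_of_lt {s t : Fin n} {S : Finset (Fin n)} (ht : t ∈ S)
    (h : t < s) : koszulSign s S * koszulSign t (S.erase s) =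
      -(koszulSign t S * koszulSign s (S.erase t)) := by
  have h1 : (S.erase s).filter (· < t) = S.filter (· < t) := by
    ext k
    simp only [Finset.mem_filter, Finset.mem_erase]
    exact ⟨fun ⟨⟨_, a⟩, b⟩ => ⟨a, b⟩, fun ⟨a, b⟩ => ⟨⟨(b.trans h).ne, a⟩, b⟩⟩
  have h2 : (S.filter (· < s)).card = ((S.erase t).filter (· < s)).card + 1 := by
    rw [Finset.filter_erase, Finset.card_erase_add_one (by simp [ht, h])]
  rw [koszulSign, koszulSign, koszulSign, koszulSign, h1, h2, pow_succ]
  ring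

theorem koszulSign_swap {s t : Fin n} {S : Finset (Fin n)} (hs : s ∈ S) (ht : t ∈ S)
    (h : s ≠ t) : koszulSign s S * koszulSign t (S.erase s) =
      -(koszulSign t S * koszulSign s (S.erase t)) := by
  rcases lt_or_gt_of_ne h with h | h
  · rw [koszulSign_swap_of_lt hs h, neg_neg]
  · exact koszulSign_swap_of_lt ht h

/-- The indices that occur in the monomial `x^β e_S`. -/
def occurring (S : Finset (Fin n)) (β : Fin n → ℕ) : Finset (Fin n) :=
  S ∪ Finset.univ.filter (β · ≠ 0)

theorem mem_occurring {S : Finset (Fin n)} {β : Fin n → ℕ} {i : Fin n} :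
    i ∈ occurring S β ↔ i ∈ S ∨ β i ≠ 0 := by simp [occurring]

/-- The boundary preserves the set of occurring variables, so `homotopy` singles out the same
variable before and after it. -/
theorem occurring_erase {S : Finset (Fin n)} (β : Fin n → ℕ) {s : Fin n} (hs : s ∈ S) :
    occurring (S.erase s) (β + Pi.single s 1) = occurring S β := by
  ext i
  by_cases h : i = s
  · subst h; simp [mem_occurring, hs]
  · simp [mem_occurring, h]

variable {M : Type*} [AddCommGroup M]

/-- The Koszul boundary of the generator `v S β`. -/
def boundary (v : Finset (Fin n) → (Fin n → ℕ) → M) (S : Finset (Fin n)) (β : Fin n → ℕ) : M :=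
  ∑ s ∈ S, koszulSign s S • v (S.erase s) (β + Pi.single s 1)

/-- The contracting homotopy of the Koszul complex: move the first occurring variable from the
polynomial part into the exterior part. -/
def homotopy (v : Finset (Fin n) → (Fin n → ℕ) → M) (S : Finset (Fin n)) (β : Fin n → ℕ) : M :=
  if h : (occurring S β).Nonempty then
    if (occurring S β).min' h ∈ S then 0
    else v (insert ((occurring S β).min' h) S) (β - Pi.single ((occurring S β).min' h) 1)
  else 0

theorem boundary_boundary (v : Finset (Fin n) → (Fin n → ℕ) → M) (S : Finset (Fin n))
    (β : Fin n → ℕ) : boundary (boundary v) S β = 0 := by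
  simp only [boundary, Finset.smul_sum, smul_smul]
  rw [Finset.sum_sigma']
  -- Removing `s` then `t` cancels against removing `t` then `s`.
  refine Finset.sum_involution (fun p _ => ⟨p.2, p.1⟩) ?_ ?_ ?_ ?_
  · rintro ⟨s, t⟩ h
    obtain ⟨hs, hts, ht⟩ : s ∈ S ∧ t ≠ s ∧ t ∈ S := by simpa using h
    simp only
    rw [koszulSign_swap hs ht hts.symm, neg_smul, Finset.erase_right_comm, add_right_comm,
      neg_add_cancel]
  · rintro ⟨s, t⟩ h _
    obtain ⟨hs, hts, ht⟩ : s ∈ S ∧ t ≠ s ∧ t ∈ S := by simpa using h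
    intro h2
    exact hts (congrArg Sigma.fst h2)
  · rintro ⟨s, t⟩ h
    obtain ⟨hs, hts, ht⟩ : s ∈ S ∧ t ≠ s ∧ t ∈ S := by simpa using h
    simp [hs, ht, hts.symm]
  · rintro ⟨s, t⟩ _
    rfl

theorem homotopy_eq (v : Finset (Fin n) → (Fin n → ℕ) → M) {S : Finset (Fin n)} {β : Fin n → ℕ}
    {m : Fin n} (hm : m ∈ occurring S β) (hmin : ∀ i ∈ occurring S β, m ≤ i) :
    homotopy v S β = if m ∈ S then 0 else v (insert m S) (β - Pi.single m 1) := by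
  have h : (occurring S β).min' ⟨m, hm⟩ = m :=
    le_antisymm (Finset.min'_le _ _ hm) (Finset.le_min' _ _ _ hmin)
  rw [homotopy, dif_pos ⟨m, hm⟩, h]

theorem exists_min_occurring {S : Finset (Fin n)} {β : Fin n → ℕ} (h : S.Nonempty ∨ β ≠ 0) :
    ∃ m ∈ occurring S β, ∀ i ∈ occurring S β, m ≤ i := by
  have hne : (occurring S β).Nonempty := by
    rcases h with ⟨i, hi⟩ | h
    · exact ⟨i, mem_occurring.2 (Or.inl hi)⟩
    · obtain ⟨i, hi⟩ := Function.ne_iff.1 h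
      exact ⟨i, mem_occurring.2 (Or.inr hi)⟩
  exact ⟨_, Finset.min'_mem _ hne, fun i hi => Finset.min'_le _ _ hi⟩

theorem koszulSign_of_le {m : Fin n} {S : Finset (Fin n)} (h : ∀ i ∈ S, m ≤ i) :
    koszulSign m S = 1 := by
  rw [koszulSign, Finset.filter_false_of_mem fun i hi => (h i hi).not_gt]
  simp

theorem koszulSign_insert {m s : Fin n} {S : Finset (Fin n)} (hm : m ∉ S) (h : m < s) :
    koszulSign s (insert m S) = -koszulSign s S := by
  rw [koszulSign, koszulSign, Finset.filter_insert, if_pos h,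
    Finset.card_insert_of_notMem (by simp [hm]), pow_succ]
  ring

/-- Let `m` be the first occurring variable. If `m ∈ S`, the homotopy kills the generator and every
boundary term except the one removing `m`, which it sends back to `v S β`. If `m ∉ S`, the boundary
of the homotopy gives `v S β` from removing `m`; its other terms cancel against the homotopy of the
boundary, since inserting `m` below `s` flips the sign. -/
theorem homotopy_boundary (v D h : Finset (Fin n) → (Fin n → ℕ) → M)
    (hD : D = boundary v) (hh : h = homotopy v) {S : Finset (Fin n)} {β : Fin n → ℕ}
    (hne : S.Nonempty ∨ β ≠ 0) : homotopy D S β + boundary h S β = v S β := by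
  subst hD hh
  obtain ⟨m, hm, hmin⟩ := exists_min_occurring hne
  have hSle : ∀ i ∈ S, m ≤ i := fun i hi => hmin i (mem_occurring.2 (Or.inl hi))
  have hstep {s : Fin n} (hs : s ∈ S) : homotopy v (S.erase s) (β + Pi.single s 1) =
      if m ∈ S.erase s then 0
      else v (insert m (S.erase s)) (β + Pi.single s 1 - Pi.single m 1) :=
    homotopy_eq v (by rwa [occurring_erase β hs]) (by rwa [occurring_erase β hs])
  by_cases hmS : m ∈ S
  · rw [homotopy_eq _ hm hmin, if_pos hmS, zero_add, boundary, Finset.sum_eq_single m]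
    · rw [hstep hmS, if_neg (Finset.notMem_erase m S), Finset.insert_erase hmS,
        koszulSign_of_le hSle, one_smul, add_tsub_cancel_right]
    · intro s hs hsm
      rw [hstep hs, if_pos (Finset.mem_erase.2 ⟨hsm.symm, hmS⟩), smul_zero]
    · exact fun h => absurd hmS h
  · have hβ : Pi.single m 1 ≤ β := by
      have h := (mem_occurring.1 hm).resolve_left hmS
      intro i
      by_cases him : i = m
      · subst him; simpa using Nat.one_le_iff_ne_zero.2 h
      · simp [him]
    rw [homotopy_eq _ hm hmin, if_neg hmS, boundary, Finset.sum_insert hmS,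
      Finset.erase_insert hmS, tsub_add_cancel_of_le hβ,
      koszulSign_of_le (by simpa using hSle), one_smul, add_assoc, boundary,
      ← Finset.sum_add_distrib, Finset.sum_eq_zero, add_zero]
    intro s hs
    have hms : m ≠ s := fun h => hmS (h ▸ hs)
    rw [hstep hs, if_neg fun h => hmS (Finset.mem_of_mem_erase h),
      koszulSign_insert hmS (lt_of_le_of_ne (hSle s hs) hms),
      Finset.erase_insert_of_ne hms, tsub_add_eq_add_tsub hβ, neg_smul, neg_add_cancel]

/-- As `v` is arbitrary, applying an operator to a boundary only replaces `v`; composites of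
operators thus become nested formal expressions. -/
theorem map_boundary {N F : Type*} [AddCommGroup N] [FunLike F M N] [AddMonoidHomClass F M N]
    (f : F) (v : Finset (Fin n) → (Fin n → ℕ) → M) (S : Finset (Fin n)) (β : Fin n → ℕ) :
    f (boundary v S β) = boundary (fun S β => f (v S β)) S β := by
  simp [boundary]

theorem map_homotopy {N F : Type*} [AddCommGroup N] [FunLike F M N] [AddMonoidHomClass F M N]
    (f : F) (v : Finset (Fin n) → (Fin n → ℕ) → M) (S : Finset (Fin n)) (β : Fin n → ℕ) :
    f (homotopy v S β) = homotopy (fun S β => f (v S β)) S β := by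
  simp only [homotopy]
  split_ifs <;> simp

end KoszulComplex

/-! ### The quantum Koszul complex, with all exterior degrees together. -/

section TotalComplex

variable {K : Type u} [Field K] {n : ℕ} {B : Type v} [Ring B] [Algebra K B]

/-- The differential of the Koszul complex of the quantum affine space, on the direct sum of all
its terms. -/
noncomputable def koszulD (c : Fin n → Fin n → K) (y : Fin n → B) :
    (Finset (Fin n) →₀ B) →ₗ[B] (Finset (Fin n) →₀ B) :=
  Finsupp.linearCombination B fun S => ∑ s ∈ S, koszulSign s S • Finsupp.single (S.erase s)
    ((∏ t ∈ S.erase s, twist c (Pi.single s 1) t)⁻¹ • y s)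

theorem koszulD_single (c : Fin n → Fin n → K) (y : Fin n → B) (S : Finset (Fin n)) (a : B) :
    koszulD c y (Finsupp.single S a) = ∑ s ∈ S, koszulSign s S • Finsupp.single (S.erase s)
      ((∏ t ∈ S.erase s, twist c (Pi.single s 1) t)⁻¹ • (a * y s)) := by
  rw [koszulD, Finsupp.linearCombination_single, Finset.smul_sum]
  refine Finset.sum_congr rfl fun s _ => ?_
  rw [smul_comm, Finsupp.smul_single, smul_eq_mul, mul_smul_comm]

/-- The rescaled monomials of the Koszul complex, on which the differential has coefficients
`±1`. -/
noncomputable def koszulMonomial (c : Fin n → Fin n → K) (b : (Fin n → ℕ) → B)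
    (S : Finset (Fin n)) (β : Fin n → ℕ) : Finset (Fin n) →₀ B :=
  (∏ t ∈ S, twist c β t)⁻¹ • Finsupp.single S (b β)

variable {c : Fin n → Fin n → K} {y : Fin n → B}

/-- Since `twist` is multiplicative in the exponent, the factor from `b β * y s`, the constant in
`koszulD` and the rescaling of the source combine to the rescaling of the target. -/
theorem koszulD_monomial (hc : ∀ i j, c i j ≠ 0) {b : (Fin n → ℕ) → B}
    (hb : ∀ β s, b β * y s = twist c β s • b (β + Pi.single s 1))
    (S : Finset (Fin n)) (β : Fin n → ℕ) :
    koszulD c y (koszulMonomial c b S β) = boundary (koszulMonomial c b) S β := by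
  rw [koszulMonomial, LinearMap.map_smul_of_tower, koszulD_single, Finset.smul_sum, boundary]
  refine Finset.sum_congr rfl fun s hs => ?_
  rw [smul_comm, hb, smul_smul, koszulMonomial, ← Finsupp.smul_single, smul_smul]
  congr 2
  rw [← Finset.mul_prod_erase S _ hs]
  simp only [twist_add, Finset.prod_mul_distrib, mul_inv]
  have := twist_ne_zero hc β s
  field_simp

theorem koszulMonomial_ext (hc : ∀ i j, c i j ≠ 0) (b : Module.Basis (Fin n → ℕ) K B)
    {N : Type*} [AddCommGroup N] [Module K N] {f g : (Finset (Fin n) →₀ B) →ₗ[K] N}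
    (h : ∀ S β, f (koszulMonomial c b S β) = g (koszulMonomial c b S β)) : f = g := by
  refine (Finsupp.basis fun _ : Finset (Fin n) => b).ext ?_
  rintro ⟨S, β⟩
  have h0 : ∏ t ∈ S, twist c β t ≠ 0 :=
    Finset.prod_ne_zero_iff.2 fun t _ => twist_ne_zero hc β t
  have h1 := h S β
  simp only [koszulMonomial, map_smul] at h1
  rw [Finsupp.coe_basis]
  exact smul_right_injective N (inv_ne_zero h0) h1

/-- The contracting homotopy, on the direct sum of all terms. -/
noncomputable def koszulH (c : Fin n → Fin n → K) (b : Module.Basis (Fin n → ℕ) K B) :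
    (Finset (Fin n) →₀ B) →ₗ[K] (Finset (Fin n) →₀ B) :=
  (Finsupp.basis fun _ : Finset (Fin n) => b).constr K fun p =>
    -- The scalar undoes the rescaling in `koszulMonomial`, because the map is prescribed on the
    -- unscaled basis.
    (∏ t ∈ p.1, twist c p.2 t) • homotopy (koszulMonomial c b) p.1 p.2

theorem koszulH_monomial (hc : ∀ i j, c i j ≠ 0) (b : Module.Basis (Fin n → ℕ) K B)
    (S : Finset (Fin n)) (β : Fin n → ℕ) :
    koszulH c b (koszulMonomial c b S β) = homotopy (koszulMonomial c b) S β := by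
  have h0 : ∏ t ∈ S, twist c β t ≠ 0 :=
    Finset.prod_ne_zero_iff.2 fun t _ => twist_ne_zero hc β t
  have h : koszulH c b (Finsupp.single S (b β)) =
      (∏ t ∈ S, twist c β t) • homotopy (koszulMonomial c b) S β := by
    have h := (Finsupp.basis fun _ : Finset (Fin n) => b).constr_basis K
      (fun p => (∏ t ∈ p.1, twist c p.2 t) • homotopy (koszulMonomial c b) p.1 p.2) ⟨S, β⟩
    rwa [Finsupp.coe_basis] at h
  rw [koszulMonomial, map_smul, h, smul_smul, inv_mul_cancel₀ h0, one_smul]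

variable (b : Module.Basis (Fin n → ℕ) K B)

theorem koszulD_koszulD (hc : ∀ i j, c i j ≠ 0)
    (hb : ∀ β s, b β * y s = twist c β s • b (β + Pi.single s 1)) (z : Finset (Fin n) →₀ B) :
    koszulD c y (koszulD c y z) = 0 := by
  have h : (koszulD c y).restrictScalars K ∘ₗ (koszulD c y).restrictScalars K = 0 := by
    refine koszulMonomial_ext hc b fun S β => ?_
    simp only [LinearMap.comp_apply, LinearMap.restrictScalars_apply, LinearMap.zero_apply]
    rw [koszulD_monomial hc hb, map_boundary]
    simp only [koszulD_monomial hc hb]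
    exact boundary_boundary _ S β
  exact LinearMap.congr_fun h z

/-- The homotopy fails only at the monomial `1` in exterior degree zero, where both operators
vanish; the augmentation term accounts for it. -/
theorem koszul_homotopy (hc : ∀ i j, c i j ≠ 0) (hb0 : b 0 = 1)
    (hb : ∀ β s, b β * y s = twist c β s • b (β + Pi.single s 1))
    (ε : B →ₐ[K] K) (hε : ∀ β ≠ 0, ε (b β) = 0) (z : Finset (Fin n) →₀ B) :
    koszulD c y (koszulH c b z) + koszulH c b (koszulD c y z) =
      z - ε (z ∅) • Finsupp.single ∅ 1 := by
  have h : (koszulD c y).restrictScalars K ∘ₗ koszulH c b +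
      koszulH c b ∘ₗ (koszulD c y).restrictScalars K = LinearMap.id -
      (ε.toLinearMap ∘ₗ Finsupp.lapply ∅).smulRight (Finsupp.single ∅ (1 : B)) := by
    refine koszulMonomial_ext hc b fun S β => ?_
    simp only [LinearMap.comp_apply, LinearMap.restrictScalars_apply, LinearMap.add_apply,
      LinearMap.sub_apply, LinearMap.id_apply, LinearMap.smulRight_apply, Finsupp.lapply_apply,
      AlgHom.toLinearMap_apply]
    rw [koszulD_monomial hc hb, koszulH_monomial hc, map_boundary, map_homotopy]
    simp only [koszulD_monomial hc hb, koszulH_monomial hc]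
    by_cases hne : S.Nonempty ∨ β ≠ 0
    · refine (homotopy_boundary (koszulMonomial c b) _ _ rfl rfl hne).trans ?_
      have h0 : ε (koszulMonomial c b S β ∅) = 0 := by
        rcases Finset.eq_empty_or_nonempty S with rfl | hS
        · simp [koszulMonomial, hε β (hne.resolve_left (by simp))]
        · simp [koszulMonomial, Finsupp.single_eq_of_ne hS.ne_empty.symm]
      rw [h0, zero_smul, sub_zero]
    · obtain ⟨rfl, rfl⟩ : S = ∅ ∧ β = 0 := by
        simpa [not_or, Finset.not_nonempty_iff_eq_empty] using hne
      simp [homotopy, occurring, boundary, koszulMonomial, hb0]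
  exact LinearMap.congr_fun h z

theorem koszulD_augmentation (hc : ∀ i j, c i j ≠ 0)
    (hb : ∀ β s, b β * y s = twist c β s • b (β + Pi.single s 1))
    (ε : B →ₐ[K] K) (hε : ∀ β ≠ 0, ε (b β) = 0) (z : Finset (Fin n) →₀ B) :
    ε (koszulD c y z ∅) = 0 := by
  have h : ε.toLinearMap ∘ₗ Finsupp.lapply ∅ ∘ₗ (koszulD c y).restrictScalars K = 0 := by
    refine koszulMonomial_ext hc b fun S β => ?_
    simp only [LinearMap.comp_apply, LinearMap.restrictScalars_apply, Finsupp.lapply_apply,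
      AlgHom.toLinearMap_apply, LinearMap.zero_apply]
    rw [koszulD_monomial hc hb, boundary, Finsupp.finsetSum_apply, map_sum]
    refine Finset.sum_eq_zero fun s _ => ?_
    have h0 : β + Pi.single s 1 ≠ 0 := fun h => by simpa using congrFun h s
    simp only [koszulMonomial, Finsupp.smul_apply, map_zsmul, map_smul, Finsupp.single_apply]
    split_ifs <;> simp [hε _ h0]
  exact LinearMap.congr_fun h z

end TotalComplex

/-! ### Splitting the complex by exterior degree. -/

section GradedComplex

variable {K : Type u} [Field K] {n : ℕ} {B : Type v} [Ring B] [Algebra K B]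

/-- The sets of indices of size `i`. -/
def sizeSets (n i : ℕ) : Set (Finset (Fin n)) := {S | S.card = i}

/-- The inclusion of the `i`-th term into the direct sum of all terms. -/
noncomputable def koszulIncl (n : ℕ) (B : Type v) [Ring B] (i : ℕ) :
    (sizeSets n i →₀ B) →ₗ[B] (Finset (Fin n) →₀ B) :=
  Finsupp.lmapDomain B B Subtype.val

/-- The projection of the direct sum of all terms to the `i`-th term. -/
noncomputable def koszulProj (n : ℕ) (B : Type v) [Ring B] (i : ℕ) :
    (Finset (Fin n) →₀ B) →ₗ[B] (sizeSets n i →₀ B) :=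
  Finsupp.lsubtypeDomain (sizeSets n i)

theorem koszulIncl_single (i : ℕ) (S : sizeSets n i) (a : B) :
    koszulIncl n B i (Finsupp.single S a) = Finsupp.single S.1 a := by
  simp [koszulIncl]

theorem koszulProj_single (i : ℕ) (S : sizeSets n i) (a : B) :
    koszulProj n B i (Finsupp.single S.1 a) = Finsupp.single S a := by
  ext S'
  change Finsupp.single S.1 a S'.1 = _
  simp [Finsupp.single_apply, Subtype.ext_iff]

theorem koszulProj_single_of_ne {i : ℕ} {S : Finset (Fin n)} (h : S.card ≠ i) (a : B) :
    koszulProj n B i (Finsupp.single S a) = 0 := by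
  ext S'
  exact Finsupp.single_eq_of_ne fun e => h (e ▸ S'.2)

theorem koszulProj_incl (i : ℕ) (z : sizeSets n i →₀ B) :
    koszulProj n B i (koszulIncl n B i z) = z := by
  induction z using Finsupp.induction_linear with
  | zero => simp
  | add f g hf hg => rw [map_add, map_add, hf, hg]
  | single S a => rw [koszulIncl_single, koszulProj_single]

theorem koszulIncl_proj_single {i : ℕ} {S : Finset (Fin n)} (h : S.card = i) (a : B) :
    koszulIncl n B i (koszulProj n B i (Finsupp.single S a)) = Finsupp.single S a := by
  rw [koszulProj_single i ⟨S, h⟩, koszulIncl_single]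

theorem koszulIncl_apply {i : ℕ} (S : sizeSets n i) (z : sizeSets n i →₀ B) :
    koszulIncl n B i z S.1 = z S :=
  Finsupp.mapDomain_apply Subtype.val_injective z S

theorem koszulIncl_apply_of_ne {i : ℕ} {S : Finset (Fin n)} (h : S.card ≠ i)
    (z : sizeSets n i →₀ B) : koszulIncl n B i z S = 0 :=
  Finsupp.mapDomain_of_notMem_range z S (by rintro ⟨S', rfl⟩; exact h S'.2)

/-- The differential of the Koszul complex. -/
noncomputable def koszulDiff (c : Fin n → Fin n → K) (y : Fin n → B) (i : ℕ) :
    (sizeSets n (i + 1) →₀ B) →ₗ[B] (sizeSets n i →₀ B) :=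
  koszulProj n B i ∘ₗ koszulD c y ∘ₗ koszulIncl n B (i + 1)

variable (c : Fin n → Fin n → K) (y : Fin n → B)

/-- The total differential removes one index, so the projection in `koszulDiff` loses nothing. -/
theorem koszulIncl_diff (i : ℕ) (z : sizeSets n (i + 1) →₀ B) :
    koszulIncl n B i (koszulDiff c y i z) = koszulD c y (koszulIncl n B (i + 1) z) := by
  induction z using Finsupp.induction_linear with
  | zero => simp
  | add f g hf hg => simp only [map_add, hf, hg]
  | single S a =>
    simp only [koszulDiff, LinearMap.comp_apply, koszulIncl_single, koszulD_single, map_sum,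
      map_zsmul]
    refine Finset.sum_congr rfl fun s hs => ?_
    rw [koszulIncl_proj_single]
    rw [Finset.card_erase_of_mem hs, S.2, Nat.add_sub_cancel]

theorem koszulDiff_proj (i : ℕ) (z : Finset (Fin n) →₀ B) :
    koszulDiff c y i (koszulProj n B (i + 1) z) = koszulProj n B i (koszulD c y z) := by
  induction z using Finsupp.induction_linear with
  | zero => simp
  | add f g hf hg => simp only [map_add, hf, hg]
  | single S a =>
    by_cases h : S.card = i + 1
    · rw [koszulDiff, LinearMap.comp_apply, LinearMap.comp_apply, koszulIncl_proj_single h]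
    · rw [koszulProj_single_of_ne h, map_zero, koszulD_single, map_sum]
      refine (Finset.sum_eq_zero fun s hs => ?_).symm
      rw [map_zsmul, koszulProj_single_of_ne, smul_zero]
      rw [Finset.card_erase_of_mem hs]
      have := Finset.card_pos.2 ⟨s, hs⟩
      omega

theorem koszulDiff_single_mem (N : Submodule K B) (hN : ∀ s, y s ∈ N) (i : ℕ)
    (S : sizeSets n (i + 1)) (S' : sizeSets n i) :
    koszulDiff c y i (Finsupp.single S 1) S' ∈ N := by
  rw [← koszulIncl_apply, koszulIncl_diff, koszulIncl_single, koszulD_single,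
    Finsupp.finsetSum_apply]
  refine sum_mem fun s _ => ?_
  rw [Finsupp.smul_apply, Finsupp.single_apply, one_mul]
  refine zsmul_mem ?_ _
  split_ifs
  exacts [Submodule.smul_mem _ _ (hN s), zero_mem _]

variable {c y} (b : Module.Basis (Fin n → ℕ) K B)

theorem koszulDiff_exact (hc : ∀ i j, c i j ≠ 0) (hb0 : b 0 = 1)
    (hb : ∀ β s, b β * y s = twist c β s • b (β + Pi.single s 1))
    (ε : B →ₐ[K] K) (hε : ∀ β ≠ 0, ε (b β) = 0) (i : ℕ) :
    Function.Exact (koszulDiff c y (i + 1)) (koszulDiff c y i) := by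
  intro z
  constructor
  · intro hz
    have h := koszul_homotopy b hc hb0 hb ε hε (koszulIncl n B (i + 1) z)
    -- In exterior degree `i + 1 > 0` the component at `∅` is zero, so the augmentation term drops
    -- out.
    rw [← koszulIncl_diff, hz, map_zero, map_zero, add_zero,
      koszulIncl_apply_of_ne (by simp), map_zero, zero_smul, sub_zero] at h
    refine ⟨koszulProj n B (i + 2) (koszulH c b (koszulIncl n B (i + 1) z)), ?_⟩
    rw [koszulDiff_proj, h, koszulProj_incl]
  · rintro ⟨w, rfl⟩
    rw [← koszulProj_incl (i + 2) w, koszulDiff_proj, koszulDiff_proj, koszulD_koszulD b hc hb,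
      map_zero]

/-- The augmentation of the Koszul complex. -/
noncomputable def koszulAug (ε : B →ₐ[K] K) :
    (sizeSets n 0 →₀ B) →ₛₗ[(ε : B →+* K)] K where
  toFun z := ε (z ⟨∅, rfl⟩)
  map_add' z w := by simp
  map_smul' r z := by simp

theorem koszulAug_surjective (ε : B →ₐ[K] K) :
    Function.Surjective (koszulAug (n := n) ε) := fun r =>
  ⟨Finsupp.single ⟨∅, rfl⟩ (algebraMap K B r),
    (congrArg ε (Finsupp.single_eq_same)).trans (ε.commutes r)⟩

theorem koszulDiff_exact_zero (hc : ∀ i j, c i j ≠ 0) (hb0 : b 0 = 1)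
    (hb : ∀ β s, b β * y s = twist c β s • b (β + Pi.single s 1))
    (ε : B →ₐ[K] K) (hε : ∀ β ≠ 0, ε (b β) = 0) :
    Function.Exact (koszulDiff c y 0) (koszulAug ε) := by
  have hε' (z : sizeSets n 0 →₀ B) : koszulAug ε z = ε (koszulIncl n B 0 z ∅) :=
    congrArg ε (koszulIncl_apply ⟨∅, rfl⟩ z).symm
  intro z
  rw [hε']
  constructor
  · intro hz
    have hD : koszulD c y (koszulIncl n B 0 z) = 0 := by
      clear hz
      induction z using Finsupp.induction_linear with
      | zero => simp
      | add f g hf hg => rw [map_add, map_add, hf, hg, add_zero]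
      | single S a =>
        rw [koszulIncl_single, Finset.card_eq_zero.1 S.2, koszulD_single, Finset.sum_empty]
    have h := koszul_homotopy b hc hb0 hb ε hε (koszulIncl n B 0 z)
    rw [hD, map_zero, add_zero, hz, zero_smul, sub_zero] at h
    refine ⟨koszulProj n B 1 (koszulH c b (koszulIncl n B 0 z)), ?_⟩
    rw [koszulDiff_proj, h, koszulProj_incl]
  · rintro ⟨w, rfl⟩
    rw [koszulIncl_diff]
    exact koszulD_augmentation b hc hb ε hε _

end GradedComplex

/-! ### Koszulness of the quantum space and of `A`. -/

section Main

variable {K : Type u} [Field K] {n : ℕ}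

/-- Stated for any generating set `T` of the ideal, since the quadratic parts of `S` need not be the
quantum relations themselves. -/
theorem isHomogeneousKoszul_of_span_eq {c : Fin n → Fin n → K}
    (hc : ∀ i j, c i j * c j i = 1) (hc' : ∀ i, c i i = 1) {T : Set (FreeAlgebra K (Fin n))}
    (hT : TwoSidedIdeal.span T = TwoSidedIdeal.span (quantumRelations c))
    (hT2 : T ⊆ wordSpan K n 2) : IsHomogeneousKoszul T := by
  have hc0 (i j : Fin n) : c i j ≠ 0 := left_ne_zero_of_mul_eq_one (hc i j)
  obtain ⟨b, hb0, hb⟩ := exists_quantumBasis hc hc' hT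
  have hε : ∀ β ≠ 0, augmentation T hT2 (b β) = 0 := by
    intro β hβ
    obtain ⟨s, hs⟩ := Function.ne_iff.1 hβ
    have hle : Pi.single s 1 ≤ β := by
      intro i
      by_cases h : i = s
      · subst h; simpa using Nat.one_le_iff_ne_zero.2 hs
      · simp [h]
    -- A nonconstant monomial is, up to a nonzero scalar, a right multiple of some generator, which
    -- the augmentation kills.
    have h := congrArg (augmentation T hT2) (hb (β - Pi.single s 1) s)
    have hs0 : augmentation T hT2 (toPresented T (FreeAlgebra.ι K s)) = 0 :=
      freeAug_eq_zero one_ne_zero (ι_mem_wordSpan s)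
    rw [map_mul, hs0, mul_zero, map_smul, tsub_add_cancel_of_le hle] at h
    exact (smul_eq_zero.1 h.symm).resolve_left (twist_ne_zero hc0 _ _)
  exact ⟨hT2, fun i => sizeSets n i, koszulDiff c fun s => toPresented T (FreeAlgebra.ι K s),
    koszulAug (augmentation T hT2),
    koszulDiff_single_mem c _ _ fun s => Submodule.mem_map_of_mem (ι_mem_wordSpan s),
    koszulAug_surjective _, koszulDiff_exact_zero b hc0 hb0 hb _ hε,
    koszulDiff_exact b hc0 hb0 hb _ hε⟩

variable {A : Type v} [Ring A] [Algebra K A]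

theorem isKoszul_of_subset (x : Fin n → A) (hA : IsSkewPBWExtension (algebraMap K A) x)
    {c : Fin n → Fin n → K} {a : Fin n → Fin n → Fin n → K}
    (hx : ∀ i j, x j * x i - c i j • (x i * x j) = ∑ t, a i j t • x t)
    {S : Set (FreeAlgebra K (Fin n))} (h₁ : skewRelations c a ⊆ S) (h₂ : S ⊆ allRelations K x) :
    IsKoszul x S := by
  have hx' (i j : Fin n) : x j * x i - c i j • (x i * x j) ∈ Submodule.span K (Set.range x) := by
    rw [hx]
    exact sum_mem fun t _ => Submodule.smul_mem _ _ (Submodule.subset_span ⟨t, rfl⟩)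
  exact ⟨isPreKoszul_of_subset x hA h₁ h₂,
    isHomogeneousKoszul_of_span_eq (coeff_mul_coeff x hA hx') (coeff_self x hA hx')
      (span_quadraticParts_eq x hA hx h₁ h₂) fun q hq => hq.1⟩

end Main

end SkewPBW

theorem theorem3p14 {K : Type*} [Field K] {A : Type*} [Ring A] [Algebra K A] {n : ℕ}
    (x : Fin n → A) (hA : SkewPBW.IsPreCommutative (algebraMap K A) x) :
    SkewPBW.IsKoszul x (SkewPBW.allRelations K x) ∧
    ∀ (c : Fin n → Fin n → K) (a : Fin n → Fin n → Fin n → K),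
      (∀ i j, c i j ≠ 0) →
      (∀ i j, x j * x i - c i j • (x i * x j) = ∑ t, a i j t • x t) →
      SkewPBW.IsKoszul x (SkewPBW.skewRelations c a) ∧
      TwoSidedIdeal.span (SkewPBW.quadraticParts (SkewPBW.skewRelations c a)) =
        TwoSidedIdeal.span (SkewPBW.quantumRelations c) ∧
      TwoSidedIdeal.span (SkewPBW.quadraticParts (SkewPBW.allRelations K x)) =
        TwoSidedIdeal.span (SkewPBW.quantumRelations c) := by
  have hPBW := hA.toIsSkewPBWExtension
  refine ⟨?_, fun c a _ hx => ?_⟩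
  · choose c _ a hx using hA.var_comm_linear
    have hx' (i j : Fin n) : x j * x i - c i j • (x i * x j) = ∑ t, a i j t • x t := by
      simpa only [Algebra.smul_def] using hx i j
    exact SkewPBW.isKoszul_of_subset x hPBW hx'
      (SkewPBW.skewRelations_subset_allRelations hx') subset_rfl
  · have hS := SkewPBW.skewRelations_subset_allRelations hx
    exact ⟨SkewPBW.isKoszul_of_subset x hPBW hx subset_rfl hS,
      SkewPBW.span_quadraticParts_eq x hPBW hx subset_rfl hS,
      SkewPBW.span_quadraticParts_eq x hPBW hx hS subset_rfl⟩
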